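/- Let $E/F$ be a finite Galois extension of nonarchimedean local fields with Galois group $G$, ring of integers $\mathfrak{o}_E$ and maximal ideal $\mathfrak{p}_E$ (and likewise for $F$), and suppose that $E/F$ is tamely ramified, i.e. the residue characteristic does not divide the ramification index $e(E/F)$. For an integer $n\ge 0$ and $K\in\{E,F\}$ let $\mathcal{U}_K^{n}$ be the group of units of $\mathfrak{o}_K$ congruent to $1$ modulo $\mathfrak{p}_K^{n}$ (so $\mathcal{U}_K^{0}=\mathfrak{o}_K^\times$), and for a real number $\nu\ge 0$ put $\mathcal{U}_K^{\nu}=\mathcal{U}_K^{\lceil\nu\rceil}$. For an integer $i\ge -1$ let $G_i=\{\sigma\in G:\sigma x-x\in\mathfrak{p}_E^{i+1}\text{ for all }x\in\mathfrak{o}_E\}$, for real $t\ge -1$ put $G_t=G_{\lceil t\rceil}$, and let $\psi=\psi_{E/F}$ be the Hasse--Herbrand function, the inverse of the bijection $\varphi_{E/F}:[-1,\infty)\to[-1,\infty)$, $\varphi_{E/F}(u)=\int_0^u \frac{dt}{(G_0:G_t)}$. Then $$N_{E/F}\bigl(\mathcal{U}_E^{\psi(\nu)}\bigr)=\mathcal{U}_F^{\nu}$$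 for every real number $\nu>0$, and also for $\nu=0$ if $E/F$ is unramified. -/

import Mathlib

open ValuativeRel

noncomputable section

namespace LocalFieldNorm

section OneField

variable (K : Type*) [Field K] [ValuativeRel K] [TopologicalSpace K] [IsNonarchimedeanLocalField K]

/-- The power `𝔭_K ^ n` of the maximal ideal of the ring of integers `𝔬_K`, as an additive
subgroup of `K` (so `𝔭_K ^ 0 = 𝔬_K`). -/
def primePow (n : ℕ) : AddSubgroup K :=
  ((𝓂[K] ^ n).toAddSubgroup).map (𝒪[K].subtype : 𝒪[K] →+ K)

/-- The unit group `U_K ^ n` as a subgroup of `Kˣ`: the units of `𝔬_K` that are congruent to `1`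
modulo `𝔭_K ^ n`. So `U_K ^ 0 = 𝔬_Kˣ` and `U_K ^ n = 1 + 𝔭_K ^ n` for `n ≥ 1`. -/
def unitGroup (n : ℕ) : Subgroup Kˣ :=
  (MonoidHom.ker (Units.map (Ideal.Quotient.mk (𝓂[K] ^ n) : 𝒪[K] →* 𝒪[K] ⧸ 𝓂[K] ^ n))).map
    (Units.map (𝒪[K].subtype : 𝒪[K] →* K))

/-- The filtration of the units with real exponents: `U_K ^ ν = U_K ^ n` for the smallest
integer `n ≥ ν` (used for `ν ≥ 0`). -/
def realUnitGroup (ν : ℝ) : Subgroup Kˣ := unitGroup K ⌈ν⌉₊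

end OneField

section Extension

variable (F E : Type*)
  [Field F] [ValuativeRel F] [TopologicalSpace F] [IsNonarchimedeanLocalField F]
  [Field E] [ValuativeRel E] [TopologicalSpace E] [IsNonarchimedeanLocalField E]
  [Algebra F E] [ValuativeExtension F E]

/-- The inclusion `𝔬_F → 𝔬_E` of rings of integers. -/
def integerMap : 𝒪[F] →+* 𝒪[E] :=
  (algebraMap F E).restrict 𝒪[F] 𝒪[E] fun x hx => by
    have h : valuation F x ≤ valuation F 1 := by
      rw [map_one]; exact (Valuation.mem_integer_iff _ _).1 hx
    have h' : algebraMap F E x ≤ᵥ algebraMap F E 1 :=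
      (ValuativeExtension.vle_iff_vle x 1).2 ((Valuation.Compatible.vle_iff_le x 1).2 h)
    have h'' := (Valuation.Compatible.vle_iff_le (v := valuation E) _ _).1 h'
    rw [map_one, map_one] at h''
    exact (Valuation.mem_integer_iff _ _).2 h''

/-- The ramification index `e(E/F)`. -/
def ramificationIndex : ℕ :=
  letI : Algebra 𝒪[F] 𝒪[E] := (integerMap F E).toAlgebra
  Ideal.ramificationIdx 𝓂[E] 𝒪[F]

/-- `E/F` is unramified: `e(E/F) = 1` (residue extensions of local fields are separable). -/
def IsUnramified : Prop := ramificationIndex F E = 1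

/-- `E/F` is tamely ramified: the residue characteristic does not divide `e(E/F)`
(residue extensions of local fields are separable). -/
def IsTamelyRamified : Prop := ¬ ringChar 𝓀[F] ∣ ramificationIndex F E

variable [FiniteDimensional F E]

/-- The ramification group in lower numbering
`G_i = {σ ∈ Gal(E/F) : σ x - x ∈ 𝔭_E ^ (i+1) for all x ∈ 𝔬_E}`, for integers `i ≥ -1`. -/
def ramificationGroup (i : ℤ) : Subgroup (E ≃ₐ[F] E) :=
  let M : Submonoid (E ≃ₐ[F] E) :=
    { carrier := {σ | ∀ x ∈ 𝒪[E], σ x - x ∈ primePow E (i + 1).toNat}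
      one_mem' := fun x _ => by simp
      mul_mem' := fun {σ τ} hσ hτ x hx => by
        have hτx : τ x ∈ 𝒪[E] := by
          obtain ⟨a, -, ha⟩ := hτ x hx
          have : τ x = (a : E) + x := sub_eq_iff_eq_add.1 ha.symm
          rw [this]; exact add_mem a.2 hx
        have := add_mem (hσ (τ x) hτx) (hτ x hx)
        simpa using this }
  { M with
    inv_mem' := fun {σ} hσ => by
      have h : σ⁻¹ = σ ^ (orderOf σ - 1) := by
        rw [inv_eq_iff_mul_eq_one, ← pow_succ', Nat.sub_add_cancel (orderOf_pos σ), pow_orderOf_eq_one]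
      rw [h]
      exact M.pow_mem hσ _ }

/-- Ramification groups with real index: `G_t = G_i` for `i - 1 < t ≤ i`. -/
def realRamificationGroup (t : ℝ) : Subgroup (E ≃ₐ[F] E) := ramificationGroup F E ⌈t⌉

/-- `φ_{E/F}(u) = ∫₀ᵘ dt / (G_0 : G_t)`, for `u ≥ -1`. -/
def herbrandPhi (u : ℝ) : ℝ :=
  ∫ t in (0 : ℝ)..u,
    (((realRamificationGroup F E t).relIndex (realRamificationGroup F E 0) : ℕ) : ℝ)⁻¹

/-- The Hasse–Herbrand function `ψ_{E/F}`, the inverse of the bijection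
`φ_{E/F} : [-1, ∞) → [-1, ∞)`. -/
def herbrandPsi : ℝ → ℝ := Function.invFunOn (herbrandPhi F E) (Set.Ici (-1))

end Extension

end LocalFieldNorm

end

open IsLocalRing
open scoped Pointwise

set_option linter.unusedSectionVars false

/-! ### Galois extensions of discrete valuation rings. -/

namespace DVRGalois

variable {A B G : Type*} [CommRing A] [IsDomain A] [IsDiscreteValuationRing A]
  [CommRing B] [IsDomain B] [IsDiscreteValuationRing B] [Algebra A B] [FaithfulSMul A B]
  [Module.Finite A B] [Group G] [Finite G] [MulSemiringAction G B] [IsGaloisGroup G A B]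

/-! Write `e` for the ramification index. Tameness kills `G_i` for `i ≥ 1`
(`eq_one_of_forall_mem_sq`), so `ψ(ν) = eν` for `ν ≥ 0`. With `m = ⌈eν⌉` and `n = ⌈ν⌉` one has `e(n
- 1) < m ≤ en`, and these inequalities are all that is used.

The norm of `y ≡ 1` mod `𝔓 ^ m` is again `≡ 1` mod `𝔓 ^ m`; as it lies in the base and `m > e(n -
1)`, it is `≡ 1` mod `𝔭 ^ n`.

Conversely, tameness gives an integer `b` of trace `1` (`exists_sum_smul_eq_one`), and `N(1 + (w -
1)b) ≡ w` mod `𝔓 ^ (2en)` when `w ≡ 1` mod `𝔭 ^ n`, `n ≥ 1`. Successive approximation and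
completeness yield an exact preimage in `1 + 𝔓 ^ (en)` (`exists_prod_smul_eq`). At `ν = 0` in the
unramified case, surjectivity of the norm between finite fields reduces units to `n = 1`. -/

variable (A B) in
theorem map_maximalIdeal_eq_pow :
    (maximalIdeal A).map (algebraMap A B) =
      maximalIdeal B ^ (maximalIdeal B).ramificationIdx A := by
  have hne : (maximalIdeal A).map (algebraMap A B) ≠ ⊥ :=
    Ideal.map_ne_bot_of_ne_bot (IsDiscreteValuationRing.not_a_field A)
  obtain ⟨ϖ, hϖ⟩ := IsDiscreteValuationRing.exists_irreducible B
  obtain ⟨k, hk⟩ := IsDiscreteValuationRing.ideal_eq_span_pow_irreducible hne hϖ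
  rw [← Ideal.span_singleton_pow, ← hϖ.maximalIdeal_eq] at hk
  rw [Ideal.IsDedekindDomain.ramificationIdx_eq_multiplicity (maximalIdeal A) _ hne, hk,
    multiplicity_pow_self (IsDiscreteValuationRing.not_a_field B)
      (fun h => (maximalIdeal.isMaximal B).ne_top (Ideal.isUnit_iff.1 h))]

variable (A G) in
theorem card_inertia [Finite (ResidueField A)] :
    Nat.card ((maximalIdeal B).inertia G) = (maximalIdeal B).ramificationIdx A := by
  have : Finite (maximalIdeal A).ResidueField :=
    have : Finite (A ⧸ maximalIdeal A) := inferInstanceAs (Finite (ResidueField A))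
    Finite.of_surjective _ (Ideal.bijective_algebraMap_quotient_residueField (maximalIdeal A)).2
  rw [Ideal.card_inertia_eq_ramificationIdxIn (R := A) (maximalIdeal A),
    Ideal.ramificationIdxIn_eq_ramificationIdx (maximalIdeal A) (maximalIdeal B) G]

theorem smul_mem_maximalIdeal_iff (g : G) {x : B} :
    g • x ∈ maximalIdeal B ↔ x ∈ maximalIdeal B := by
  rw [mem_maximalIdeal, mem_maximalIdeal, mem_nonunits_iff, mem_nonunits_iff,
    ← isUnit_map_iff (MulSemiringAction.toRingEquiv G B g) x, MulSemiringAction.toRingEquiv_apply_apply]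

theorem smul_mem_maximalIdeal_pow (g : G) {n : ℕ} {x : B} (hx : x ∈ maximalIdeal B ^ n) :
    g • x ∈ maximalIdeal B ^ n := by
  have hle : (maximalIdeal B).map (MulSemiringAction.toRingEquiv G B g : B →+* B) ≤
      maximalIdeal B :=
    Ideal.map_le_iff_le_comap.2 fun y hy => (smul_mem_maximalIdeal_iff g).2 hy
  have := Ideal.mem_map_of_mem (MulSemiringAction.toRingEquiv G B g : B →+* B) hx
  rw [Ideal.map_pow] at this
  exact Ideal.pow_right_mono hle n this

/-- An element of the base congruent to `0` modulo `𝔓 ^ m` with `m > e (n - 1)` is congruent to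
`0` modulo `𝔭 ^ n`. -/
theorem mem_pow_of_algebraMap_mem_pow {m n : ℕ}
    (h : (maximalIdeal B).ramificationIdx A * n < m + (maximalIdeal B).ramificationIdx A)
    {a : A} (ha : algebraMap A B a ∈ maximalIdeal B ^ m) : a ∈ maximalIdeal A ^ n := by
  rcases eq_or_ne a 0 with rfl | ha0
  · exact zero_mem _
  obtain ⟨ϖ, hϖ⟩ := IsDiscreteValuationRing.exists_irreducible A
  obtain ⟨k, u, rfl⟩ := IsDiscreteValuationRing.eq_unit_mul_pow_irreducible ha0 hϖ
  set e := (maximalIdeal B).ramificationIdx A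
  have hk : maximalIdeal B ^ (e * k) ≤ maximalIdeal B ^ m := by
    rw [pow_mul, ← map_maximalIdeal_eq_pow, ← Ideal.map_pow, hϖ.maximalIdeal_eq,
      Ideal.span_singleton_pow, Ideal.map_span, Set.image_singleton, Ideal.span_singleton_le_iff_mem]
    rw [map_mul] at ha
    exact (Ideal.unit_mul_mem_iff_mem _ (u.isUnit.map _)).1 ha
  have hmk : m ≤ e * k := (Ideal.pow_right_strictAnti (maximalIdeal B)
    (IsDiscreteValuationRing.not_a_field B) (maximalIdeal.isMaximal B).ne_top).le_iff_ge.1 hk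
  have hnk : n ≤ k := by
    by_contra! hlt
    have : e * (k + 1) ≤ e * n := Nat.mul_le_mul_left e hlt
    rw [mul_add] at this
    omega
  refine Ideal.mul_mem_left _ _ (Ideal.pow_le_pow_right hnk (Ideal.pow_mem_pow ?_ k))
  exact (mem_maximalIdeal _).2 hϖ.not_isUnit

theorem algebraMap_mem_pow {n : ℕ} {a : A} (ha : a ∈ maximalIdeal A ^ n) :
    algebraMap A B a ∈ maximalIdeal B ^ ((maximalIdeal B).ramificationIdx A * n) := by
  rw [pow_mul, ← map_maximalIdeal_eq_pow, ← Ideal.map_pow]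
  exact Ideal.mem_map_of_mem _ ha

variable (A G) in
/-- In the tame case the trace is surjective on integers. -/
theorem exists_sum_smul_eq_one [Fintype G] [Finite (ResidueField A)]
    (htame : ((maximalIdeal B).ramificationIdx A : ResidueField A) ≠ 0) :
    ∃ b : B, ∑ g : G, g • b = 1 := by
  classical
  -- A unit trace is the image of a unit of `A`, by which `b` can be divided.
  suffices h : ∃ b : B, IsUnit (∑ g : G, g • b) by
    obtain ⟨b, hb⟩ := h
    obtain ⟨a, ha⟩ := IsGaloisGroup.isInvariant.isInvariant (A := A) (G := G) (∑ g : G, g • b)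
      fun σ => by
        rw [Finset.smul_sum]
        exact Fintype.sum_equiv (Equiv.mulLeft σ) _ _ fun g => by simp [mul_smul]
    rw [← ha] at hb
    obtain ⟨u, rfl⟩ := isUnit_of_map_unit _ _ hb
    refine ⟨(↑u⁻¹ : A) • b, ?_⟩
    have := IsGaloisGroup.commutes (G := G) (A := A) (B := B)
    simp_rw [smul_comm _ (↑u⁻¹ : A) b, ← Finset.smul_sum, ← ha, Algebra.smul_def, ← map_mul]
    simp
  -- Otherwise the automorphisms of the residue field induced by `G`, counted with multiplicity, sum
  -- to zero. Dedekind independence kills each multiplicity in the residue field; that of the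
  -- identity is the order of inertia, namely `e`.
  by_contra! hcon
  have hzero (b : B) : ∑ g : G, residue B (g • b) = 0 := by
    rw [← map_sum]
    exact (residue_eq_zero_iff _).2 ((mem_maximalIdeal _).2 (hcon b))
  let ρ (g : G) : ResidueField B →* ResidueField B :=
    (MulSemiringAction.toRingHom G (ResidueField B) g : ResidueField B →* ResidueField B)
  have hli := linearIndependent_monoidHom (ResidueField B) (ResidueField B)
  have hsum : ∑ f ∈ Finset.univ.image ρ,
      (((Finset.univ.filter (fun g => ρ g = f)).card : ResidueField B)) •
        (f : ResidueField B → ResidueField B) = 0 := by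
    ext x
    obtain ⟨b, rfl⟩ := residue_surjective x
    have : ∑ g : G, ρ g (residue B b) = 0 := by
      simpa [ρ, ← ResidueField.residue_smul] using hzero b
    rw [← Finset.sum_fiberwise_of_maps_to (g := ρ) (t := Finset.univ.image ρ)
      (fun g _ => Finset.mem_image_of_mem _ (Finset.mem_univ g))] at this
    rw [Pi.zero_apply, ← this, Finset.sum_apply]
    refine Finset.sum_congr rfl fun f _ => ?_
    rw [Finset.sum_congr rfl (fun g hg => by rw [(Finset.mem_filter.1 hg).2])]
    simp
  have h1 := linearIndependent_iff'.1 hli _ _ hsum (ρ 1)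
    (Finset.mem_image_of_mem _ (Finset.mem_univ 1))
  apply htame
  rw [← map_eq_zero (algebraMap (ResidueField A) (ResidueField B)), map_natCast, ← card_inertia A G, ← h1,
    Nat.card_eq_fintype_card, Fintype.card_subtype]
  congr 2
  ext g
  simp only [Finset.mem_filter, Finset.mem_univ, true_and, AddSubgroup.mem_inertia]
  rw [DFunLike.ext_iff, residue_surjective.forall]
  refine forall_congr' fun b => ?_
  simp only [ρ, MonoidHom.coe_coe, MulSemiringAction.toRingHom_apply,
    ← ResidueField.residue_smul, one_smul]
  rw [← sub_eq_zero, ← map_sub, residue_eq_zero_iff]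
  rfl

/-- The property is multiplicative in `d`, so units and a uniformizer suffice; for `ϖ` the square in
the hypothesis leaves a spare factor `ϖ`. -/
theorem exists_smul_eq_mul_of_forall_mem_sq {σ : G}
    (hσ : ∀ x : B, σ • x - x ∈ maximalIdeal B ^ 2) (d : B) :
    ∃ t : B, t - 1 ∈ maximalIdeal B ∧ σ • d = d * t := by
  have hmul {c d : B} (hc : ∃ t : B, t - 1 ∈ maximalIdeal B ∧ σ • c = c * t)
      (hd : ∃ t : B, t - 1 ∈ maximalIdeal B ∧ σ • d = d * t) :
      ∃ t : B, t - 1 ∈ maximalIdeal B ∧ σ • (c * d) = c * d * t := by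
    obtain ⟨s, hs, hs'⟩ := hc
    obtain ⟨t, ht, ht'⟩ := hd
    refine ⟨s * t, ?_, by rw [smul_mul', hs', ht']; ring⟩
    rw [show s * t - 1 = s * (t - 1) + (s - 1) by ring]
    exact add_mem (Ideal.mul_mem_left _ _ ht) hs
  rcases eq_or_ne d 0 with rfl | hd
  · exact ⟨1, by simp, by simp⟩
  obtain ⟨ϖ, hϖ⟩ := IsDiscreteValuationRing.exists_irreducible B
  obtain ⟨k, u, rfl⟩ := IsDiscreteValuationRing.eq_unit_mul_pow_irreducible hd hϖ
  refine hmul ⟨↑u⁻¹ * (σ • (u : B)), ?_, by simp⟩ ?_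
  · rw [show (↑u⁻¹ : B) * (σ • (u : B)) - 1 = ↑u⁻¹ * (σ • (u : B) - u) by simp [mul_sub]]
    exact Ideal.mul_mem_left _ _ (Ideal.pow_le_self two_ne_zero (hσ u))
  · induction k with
    | zero => exact ⟨1, by simp, by simp⟩
    | succ k ih =>
      rw [pow_succ]
      refine hmul (ih (pow_ne_zero _ hϖ.ne_zero |> mul_ne_zero u.ne_zero)) ?_
      have h := hσ ϖ
      rw [hϖ.maximalIdeal_eq, Ideal.span_singleton_pow, Ideal.mem_span_singleton'] at h
      obtain ⟨c, hc⟩ := h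
      refine ⟨1 + c * ϖ, ?_, ?_⟩
      · rw [add_sub_cancel_left]
        exact Ideal.mul_mem_left _ _ ((mem_maximalIdeal _).2 hϖ.not_isUnit)
      · rw [← sub_add_cancel (σ • ϖ) ϖ, ← hc]; ring

variable (A) in
/-- In the tame case the first ramification group is trivial. -/
theorem eq_one_of_forall_mem_sq [Finite (ResidueField A)]
    (htame : ((maximalIdeal B).ramificationIdx A : ResidueField A) ≠ 0) {σ : G}
    (hσ : ∀ x : B, σ • x - x ∈ maximalIdeal B ^ 2) : σ = 1 := by
  have hpow (d : B) (j : ℕ) : ∃ t : B, t - 1 ∈ maximalIdeal B ∧ σ ^ j • d = d * t := by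
    induction j with
    | zero => exact ⟨1, by simp, by simp⟩
    | succ j ih =>
      obtain ⟨t, ht, htd⟩ := ih
      obtain ⟨s, hs, hsd⟩ := exists_smul_eq_mul_of_forall_mem_sq hσ d
      refine ⟨s * σ • t, ?_, by rw [pow_succ', mul_smul, htd, smul_mul', hsd, mul_assoc]⟩
      have h1 : σ • t - 1 ∈ maximalIdeal B := by
        rw [← smul_one σ, ← smul_sub]
        exact (smul_mem_maximalIdeal_iff σ).2 ht
      rw [show s * σ • t - 1 = s * (σ • t - 1) + (s - 1) by ring]
      exact add_mem (Ideal.mul_mem_left _ _ h1) hs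
  have := IsGaloisGroup.faithful (G := G) (A := A) (B := B)
  by_contra hne
  obtain ⟨x, hx⟩ : ∃ x : B, σ • x ≠ x := by
    by_contra! h
    exact hne (FaithfulSMul.eq_of_smul_eq_smul (α := B) fun x => by rw [h x, one_smul])
  -- The sum of `σ ^ j • (σ • x - x)` over `j < orderOf σ` telescopes to zero. Cancelling `σ • x -
  -- x` leaves a vanishing sum of elements `≡ 1`, so `orderOf σ`, a divisor of `e`, is zero in the
  -- residue field.
  choose t ht htd using hpow (σ • x - x)
  have hsum : ∑ j ∈ Finset.range (orderOf σ), t j = 0 := by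
    refine (mul_eq_zero.1 ?_).resolve_left (sub_ne_zero.2 hx)
    rw [Finset.mul_sum]
    simp_rw [← htd, smul_sub, ← mul_smul, ← pow_succ]
    rw [Finset.sum_range_sub (fun j => σ ^ j • x), pow_orderOf_eq_one]
    simp
  have hmem : σ ∈ (maximalIdeal B).inertia G := fun y => Ideal.pow_le_self two_ne_zero (hσ y)
  have hdvd : orderOf σ ∣ (maximalIdeal B).ramificationIdx A := by
    rw [← card_inertia A G]
    exact Subgroup.orderOf_dvd_natCard _ hmem
  have hzero : (orderOf σ : ResidueField B) = 0 := by
    have := congrArg (residue B) hsum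
    rw [map_sum, map_zero] at this
    rw [← this, Finset.sum_congr rfl (fun j _ => show residue B (t j) = 1 by
      rw [← sub_eq_zero, ← map_one (residue B), ← map_sub, residue_eq_zero_iff]; exact ht j)]
    simp
  obtain ⟨c, hc⟩ := hdvd
  apply htame
  rw [← map_eq_zero (algebraMap (ResidueField A) (ResidueField B)), map_natCast, hc,
    Nat.cast_mul, hzero, zero_mul]

/-! ### Norms of units: congruences and successive approximation. -/

theorem prod_smul_sub_prod_smul_mem [Fintype G] {n : ℕ} {x y : B}
    (h : x - y ∈ maximalIdeal B ^ n) :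
    ∏ g : G, g • x - ∏ g : G, g • y ∈ maximalIdeal B ^ n := by
  rw [← Ideal.Quotient.eq, map_prod, map_prod]
  refine Finset.prod_congr rfl fun g _ => ?_
  rw [Ideal.Quotient.eq, ← smul_sub]
  exact smul_mem_maximalIdeal_pow g h

theorem prod_one_add_sub_mem_sq {R ι : Type*} [CommRing R] (I : Ideal R) (s : Finset ι)
    (f : ι → R) (hf : ∀ i ∈ s, f i ∈ I) :
    ∏ i ∈ s, (1 + f i) - (1 + ∑ i ∈ s, f i) ∈ I ^ 2 := by
  classical
  induction s using Finset.induction_on with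
  | empty => simp
  | insert a s ha ih =>
    rw [Finset.prod_insert ha, Finset.sum_insert ha]
    have h := ih fun i hi => hf i (Finset.mem_insert_of_mem hi)
    have hs : ∑ i ∈ s, f i ∈ I := sum_mem fun i hi => hf i (Finset.mem_insert_of_mem hi)
    rw [show (1 + f a) * ∏ i ∈ s, (1 + f i) - (1 + (f a + ∑ i ∈ s, f i)) =
      (1 + f a) * (∏ i ∈ s, (1 + f i) - (1 + ∑ i ∈ s, f i)) + f a * ∑ i ∈ s, f i by ring]
    refine add_mem (Ideal.mul_mem_left _ _ h) ?_
    rw [pow_two]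
    exact Ideal.mul_mem_mul (hf a (Finset.mem_insert_self _ _)) hs

variable (A) in
theorem exists_algebraMap_eq_prod_smul [Fintype G] (x : B) :
    ∃ a : A, algebraMap A B a = ∏ g : G, g • x := by
  refine IsGaloisGroup.isInvariant.isInvariant (G := G) _ fun σ => ?_
  rw [Finset.smul_prod']
  exact Fintype.prod_equiv (Equiv.mulLeft σ) _ _ fun g => by simp [mul_smul]

-- One approximation step: with `b` of trace `1`, the norm of `1 + (w - 1) • b` is `w` up to `𝔓 ^
-- (2en)`. Already `𝔓 ^ (en + 1)` meets `A` inside `𝔭 ^ (n + 1)`.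
variable (G) in
theorem exists_prod_smul_sub_mem [Fintype G] [Finite (ResidueField A)]
    (htame : ((maximalIdeal B).ramificationIdx A : ResidueField A) ≠ 0) {n : ℕ} (hn : n ≠ 0)
    {w : A} (hw : w - 1 ∈ maximalIdeal A ^ n) :
    ∃ (y : B) (a : A), y - 1 ∈ maximalIdeal B ^ ((maximalIdeal B).ramificationIdx A * n) ∧
      algebraMap A B a = ∏ g : G, g • y ∧ a - w ∈ maximalIdeal A ^ (n + 1) := by
  set e := (maximalIdeal B).ramificationIdx A with he
  have he0 : e ≠ 0 := by rintro h; simp [h] at htame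
  obtain ⟨b, hb⟩ := exists_sum_smul_eq_one (B := B) A G htame
  have hcomm := IsGaloisGroup.commutes (G := G) (A := A) (B := B)
  have hmem : (w - 1) • b ∈ maximalIdeal B ^ (e * n) := by
    rw [Algebra.smul_def]
    exact Ideal.mul_mem_right _ _ (algebraMap_mem_pow hw)
  obtain ⟨a, ha⟩ := exists_algebraMap_eq_prod_smul A (G := G) (1 + (w - 1) • b)
  refine ⟨1 + (w - 1) • b, a, by simpa using hmem, ha,
    mem_pow_of_algebraMap_mem_pow (B := B) (m := e * n + 1) (by rw [mul_add, mul_one, ← he]; omega) ?_⟩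
  have h := prod_one_add_sub_mem_sq (maximalIdeal B ^ (e * n)) Finset.univ
    (fun g : G => g • ((w - 1) • b)) fun g _ => smul_mem_maximalIdeal_pow g hmem
  rw [map_sub, ha]
  simp_rw [smul_add, smul_one]
  have hs : 1 + ∑ g : G, g • ((w - 1) • b) = algebraMap A B w := by
    simp_rw [smul_comm _ (w - 1) b, ← Finset.smul_sum, hb, Algebra.smul_def]
    simp
  rw [hs, ← pow_mul] at h
  refine Ideal.pow_le_pow_right ?_ h
  have : 0 < e * n := by positivity
  omega

variable (G) in
theorem exists_prod_smul_eq [Fintype G] [Finite (ResidueField A)]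
    [IsAdicComplete (maximalIdeal B) B]
    (htame : ((maximalIdeal B).ramificationIdx A : ResidueField A) ≠ 0) {n : ℕ} (hn : n ≠ 0)
    {w : A} (hw : w - 1 ∈ maximalIdeal A ^ n) :
    ∃ y : B, y - 1 ∈ maximalIdeal B ^ ((maximalIdeal B).ramificationIdx A * n) ∧
      ∏ g : G, g • y = algebraMap A B w := by
  set e := (maximalIdeal B).ramificationIdx A with he
  have he0 : e ≠ 0 := by rintro h; simp [h] at htame
  let S (k : ℕ) (x : B) : Prop := x - 1 ∈ maximalIdeal B ^ (e * n) ∧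
    ∃ a : A, algebraMap A B a = ∏ g : G, g • x ∧ a - w ∈ maximalIdeal A ^ (n + k)
  have hstep (k : ℕ) (x : B) (hx : S k x) :
      ∃ x' : B, S (k + 1) x' ∧ x' - x ∈ maximalIdeal B ^ (e * (n + k)) := by
    obtain ⟨hx1, a, ha, haw⟩ := hx
    have ha1 : a - 1 ∈ maximalIdeal A := by
      rw [← sub_add_sub_cancel a w 1]
      exact add_mem (Ideal.pow_le_self (by omega) haw) (Ideal.pow_le_self hn hw)
    have hau : IsUnit a := by
      by_contra h
      have h1 := sub_mem ((mem_maximalIdeal a).2 h) ha1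
      rw [sub_sub_cancel] at h1
      exact (mem_maximalIdeal _).1 h1 isUnit_one
    obtain ⟨u, rfl⟩ := hau
    have hwu : ↑u⁻¹ * w - 1 ∈ maximalIdeal A ^ (n + k) := by
      rw [show ↑u⁻¹ * w - 1 = -(↑u⁻¹ * (u - w)) by simp [mul_sub]]
      exact neg_mem (Ideal.mul_mem_left _ _ haw)
    -- Correct `x` by an approximate preimage of the remaining quotient `w / N(x)`.
    obtain ⟨y, c, hy, hc, hcw⟩ := exists_prod_smul_sub_mem (B := B) G htame (by omega) hwu
    have hdiff : x * y - x ∈ maximalIdeal B ^ (e * (n + k)) := by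
      rw [show x * y - x = x * (y - 1) by ring]
      exact Ideal.mul_mem_left _ _ hy
    refine ⟨x * y, ⟨?_, u * c, ?_, ?_⟩, hdiff⟩
    · rw [← sub_add_sub_cancel _ x]
      exact add_mem (Ideal.pow_le_pow_right (Nat.mul_le_mul_left e (by omega)) hdiff) hx1
    · simp_rw [smul_mul', Finset.prod_mul_distrib, map_mul, ha, hc]
    · rw [show (u : A) * c - w = u * (c - ↑u⁻¹ * w) by simp [mul_sub]]
      exact Ideal.mul_mem_left _ _ hcw
  choose! f hf hfd using hstep
  let x (k : ℕ) : B := Nat.rec 1 f k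
  have hS (k : ℕ) : S k (x k) := by
    induction k with
    | zero => exact ⟨by simp [x], 1, by simp [x], by simpa [x] using neg_mem hw⟩
    | succ k ih => exact hf k _ ih
  have hle (k : ℕ) : k ≤ e * (n + k) :=
    (Nat.le_add_left k n).trans (Nat.le_mul_of_pos_left _ (Nat.pos_of_ne_zero he0))
  have hcauchy {m k : ℕ} (hmk : m ≤ k) : x k - x m ∈ maximalIdeal B ^ m := by
    induction k, hmk using Nat.le_induction with
    | base => simp
    | succ k hmk ih =>
      rw [← sub_add_sub_cancel _ (x k)]
      exact add_mem (Ideal.pow_le_pow_right (hmk.trans (hle k)) (hfd k _ (hS k))) ih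
  obtain ⟨y, hy⟩ := IsPrecomplete.prec' (I := maximalIdeal B) x fun {m k} hmk => by
    rw [SModEq.sub_mem, smul_eq_mul, Ideal.mul_top, ← neg_sub]
    exact neg_mem (hcauchy hmk)
  simp_rw [SModEq.sub_mem, smul_eq_mul, Ideal.mul_top] at hy
  refine ⟨y, ?_, sub_eq_zero.1 (IsHausdorff.haus (I := maximalIdeal B) inferInstance _ fun k => ?_)⟩
  · rw [show y - 1 = x (e * n) - 1 - (x (e * n) - y) by ring]
    exact sub_mem (hS _).1 (hy _)
  · rw [SModEq.zero, smul_eq_mul, Ideal.mul_top]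
    obtain ⟨-, a, ha, haw⟩ := hS k
    rw [← sub_sub_sub_cancel_left _ _ (∏ g : G, g • x k)]
    refine sub_mem ?_ (prod_smul_sub_prod_smul_mem (hy k))
    rw [← ha, ← map_sub]
    exact Ideal.pow_le_pow_right (hle k) (algebraMap_mem_pow haw)

-- Inertia is trivial when `e = 1`, so `G` is the full Galois group of the residue extension, and
-- norms of finite fields are surjective.
variable (G) in
theorem exists_prod_smul_sub_mem_of_ramificationIdx_eq_one [Fintype G] [Finite (ResidueField A)]
    (he : (maximalIdeal B).ramificationIdx A = 1) (w : A) :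
    ∃ (y : B) (a : A), algebraMap A B a = ∏ g : G, g • y ∧ a - w ∈ maximalIdeal A := by
  have hstab (g : G) : g ∈ MulAction.stabilizer G (maximalIdeal B) := by
    rw [MulAction.mem_stabilizer_iff]
    ext x
    rw [Ideal.mem_pointwise_smul_iff_inv_smul_mem, smul_mem_maximalIdeal_iff]
  have hcomm := IsGaloisGroup.commutes (G := G) (A := A) (B := B)
  have hinv := IsGaloisGroup.isInvariant (G := G) (A := A) (B := B)
  let ρ (g : G) : ResidueField B ≃ₐ[ResidueField A] ResidueField B :=
    Ideal.Quotient.stabilizerHom (maximalIdeal B) (maximalIdeal A) G ⟨g, hstab g⟩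
  have hρ (g : G) (b : B) : ρ g (residue B b) = residue B (g • b) := rfl
  have hbij : Function.Bijective ρ := by
    constructor
    · intro g h hgh
      have hmem : h⁻¹ * g ∈ (maximalIdeal B).inertia G := fun b => by
        have h1 : g • b - h • b ∈ maximalIdeal B := by
          rw [← residue_eq_zero_iff, map_sub, ← hρ, ← hρ, hgh, sub_self]
        have := (smul_mem_maximalIdeal_iff h⁻¹).2 h1
        rwa [smul_sub, inv_smul_smul, ← mul_smul] at this
      have hbot : (maximalIdeal B).inertia G = ⊥ := by
        rw [← Subgroup.card_eq_one, card_inertia A G, he]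
      rw [hbot, Subgroup.mem_bot, inv_mul_eq_one] at hmem
      exact hmem.symm
    · intro τ
      obtain ⟨g, hg⟩ := Ideal.Quotient.stabilizerHom_surjective G (maximalIdeal A)
        (maximalIdeal B) τ
      exact ⟨g, hg⟩
  have : Finite (ResidueField B) := Module.finite_of_finite (ResidueField A)
  obtain ⟨z, hz⟩ := FiniteField.norm_surjective (ResidueField A) (ResidueField B) (residue A w)
  obtain ⟨y, rfl⟩ := residue_surjective z
  obtain ⟨a, ha⟩ := exists_algebraMap_eq_prod_smul A (G := G) y
  refine ⟨y, a, ha, ?_⟩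
  rw [← residue_eq_zero_iff, map_sub, sub_eq_zero]
  apply (algebraMap (ResidueField A) (ResidueField B)).injective
  rw [← hz, Algebra.norm_eq_prod_automorphisms, ← hbij.prod_comp]
  simp_rw [hρ]
  rw [← map_prod, ← ha]
  rfl

variable (G) in
theorem exists_prod_smul_eq_of_ramificationIdx_eq_one [Fintype G] [Finite (ResidueField A)]
    [IsAdicComplete (maximalIdeal B) B] (he : (maximalIdeal B).ramificationIdx A = 1) (w : Aˣ) :
    ∃ y : B, ∏ g : G, g • y = algebraMap A B w := by
  obtain ⟨y, a, ha, haw⟩ :=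
    exists_prod_smul_sub_mem_of_ramificationIdx_eq_one (B := B) G he (w : A)
  have hau : IsUnit a := by
    by_contra h
    have h1 := sub_mem ((mem_maximalIdeal a).2 h) haw
    rw [sub_sub_cancel] at h1
    exact (mem_maximalIdeal _).1 h1 w.isUnit
  obtain ⟨u, rfl⟩ := hau
  have hwu : ↑u⁻¹ * (w : A) - 1 ∈ maximalIdeal A ^ 1 := by
    rw [pow_one, show ↑u⁻¹ * (w : A) - 1 = -(↑u⁻¹ * (u - w)) by simp [mul_sub]]
    exact neg_mem (Ideal.mul_mem_left _ _ haw)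
  obtain ⟨z, -, hz⟩ := exists_prod_smul_eq (B := B) G (by simp [he]) one_ne_zero hwu
  refine ⟨y * z, ?_⟩
  simp_rw [smul_mul', Finset.prod_mul_distrib, ← ha, hz, ← map_mul]
  simp

end DVRGalois

noncomputable section

/-! ### Integers of a local field and their stability under endomorphisms. -/

namespace LocalFieldNorm

section OneField

variable (K : Type*) [Field K] [ValuativeRel K] [TopologicalSpace K] [IsNonarchimedeanLocalField K]

instance isAdicComplete_integer : IsAdicComplete 𝓂[K] 𝒪[K] :=
  letI := IsTopologicalAddGroup.rightUniformSpace K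
  haveI := isUniformAddGroup_of_addCommGroup (G := K)
  inferInstance

variable {K}

theorem mem_integer_or_inv_mem (x : K) : x ∈ 𝒪[K] ∨ ∃ y ∈ 𝓂[K], (y : K) = x⁻¹ := by
  by_cases hx : x ∈ 𝒪[K]
  · exact .inl hx
  · rw [Valuation.mem_integer_iff, not_le] at hx
    have hlt : valuation K x⁻¹ < 1 := by
      rw [map_inv₀]
      exact inv_lt_one_of_one_lt₀ hx
    refine .inr ⟨⟨x⁻¹, (Valuation.mem_integer_iff _ _).2 hlt.le⟩, ?_, rfl⟩
    rw [mem_maximalIdeal, mem_nonunits_iff, Valuation.Integers.isUnit_iff_valuation_eq_one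
      (Valuation.integer.integers _)]
    exact hlt.ne

theorem eq_zero_of_forall_mem_pow {x : 𝒪[K]} {l : ℕ} (hl : 1 < l)
    (h : ∀ k, x ∈ 𝓂[K] ^ l ^ k) : x = 0 :=
  IsHausdorff.haus (I := 𝓂[K]) inferInstance x fun k => by
    rw [SModEq.zero, smul_eq_mul, Ideal.mul_top]
    exact Ideal.pow_le_pow_right (Nat.lt_pow_self hl).le (h k)

/-- Elements of a local field that have `l ^ k`-th roots for all `k` are integral. -/
theorem mem_integer_of_forall_exists_pow {x : K} {l : ℕ} (hl : 1 < l)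
    (h : ∀ k, ∃ y : K, y ^ l ^ k = x) : x ∈ 𝒪[K] := by
  rcases mem_integer_or_inv_mem x with hx | ⟨z, hz, hzx⟩
  · exact hx
  -- With `z = x⁻¹` in the maximal ideal, inverting the roots of `x` puts `z` in `𝓂[K] ^ l ^ k` for
  -- every `k`. Then `x = 0`, as `0⁻¹ = 0`.
  have hz0 : z = 0 := eq_zero_of_forall_mem_pow hl fun k => by
    obtain ⟨y, rfl⟩ := h k
    have hy : y⁻¹ ∈ 𝒪[K] := by
      rcases mem_integer_or_inv_mem y⁻¹ with hy | ⟨w, -, hw⟩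
      · exact hy
      · rw [inv_inv] at hw
        have hmul : (z : K) * (w : K) ^ l ^ k = 1 ∨ y = 0 := by
          rw [hzx, hw, or_iff_not_imp_right]
          exact fun hy => inv_mul_cancel₀ (pow_ne_zero _ hy)
        rcases hmul with hmul | rfl
        · exact absurd (IsUnit.of_mul_eq_one (w ^ l ^ k) (Subtype.ext hmul))
            ((mem_maximalIdeal _).1 hz)
        · simp
    have hzy : z = (⟨y⁻¹, hy⟩ : 𝒪[K]) ^ l ^ k :=
      Subtype.ext (by rw [hzx, SubmonoidClass.coe_pow, inv_pow])
    rw [hzy] at hz ⊢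
    exact Ideal.pow_mem_pow ((maximalIdeal.isMaximal _).isPrime.mem_of_pow_mem _ hz) _
  have hx0 : x = 0 := by simpa [hz0] using hzx.symm
  rw [hx0]
  exact zero_mem _

-- The exponent `l = q + 1` exceeds `1` and is a unit in the residue field, so Hensel's lemma
-- extracts `l`-th roots of principal units.
variable (K) in
theorem natCast_card_residueField_add_one : ((Nat.card 𝓀[K] + 1 : ℕ) : 𝓀[K]) = 1 := by
  have := Fintype.ofFinite 𝓀[K]
  rw [Nat.card_eq_fintype_card, Nat.cast_add, FiniteField.cast_card_eq_zero, zero_add, Nat.cast_one]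

theorem exists_one_add_pow_eq {z : 𝒪[K]} (hz : z ∈ 𝓂[K]) (k : ℕ) :
    ∃ w ∈ 𝓂[K], (1 + w) ^ (Nat.card 𝓀[K] + 1) ^ k = 1 + z := by
  induction k generalizing z with
  | zero => exact ⟨z, hz, by simp⟩
  | succ k ih =>
    set l := Nat.card 𝓀[K] + 1 with hl
    obtain ⟨a, ha, ha1⟩ := HenselianRing.is_henselian (I := 𝓂[K])
      (Polynomial.X ^ l - Polynomial.C (1 + z)) (Polynomial.monic_X_pow_sub_C _ (by omega)) 1
      (by simpa using hz) (by
        have h : IsUnit ((l : ℕ) : 𝓀[K]) := by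
          rw [hl, natCast_card_residueField_add_one]
          exact isUnit_one
        have h' : IsUnit ((l : ℕ) : 𝒪[K] ⧸ 𝓂[K]) := h
        simpa [Polynomial.derivative_X_pow] using h')
    obtain ⟨w, hw, hwa⟩ := ih ha1
    refine ⟨w, hw, ?_⟩
    rw [pow_succ, pow_mul, hwa]
    simpa [sub_eq_zero] using ha

/-- Every ring endomorphism of a local field preserves the ring of integers. -/
theorem map_mem_integer (σ : K →+* K) {x : K} (hx : x ∈ 𝒪[K]) : σ x ∈ 𝒪[K] := by
  have hl : 1 < Nat.card 𝓀[K] + 1 := by have := Nat.card_pos (α := 𝓀[K]); omega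
  have hmax (z : 𝒪[K]) (hz : z ∈ 𝓂[K]) : σ z ∈ 𝒪[K] := by
    have h1 : σ (1 + z) ∈ 𝒪[K] := mem_integer_of_forall_exists_pow hl fun k => by
      obtain ⟨w, -, hw⟩ := exists_one_add_pow_eq hz k
      refine ⟨σ (1 + w), ?_⟩
      rw [← map_pow]
      exact congrArg (fun y : 𝒪[K] => σ y) hw
    have h2 := sub_mem h1 (one_mem 𝒪[K])
    rwa [map_add, map_one, add_sub_cancel_left] at h2
  rcases mem_integer_or_inv_mem (σ x) with h | ⟨y, hy, hyx⟩
  · exact h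
  rcases eq_or_ne (σ x) 0 with hx0 | hx0
  · rw [hx0]
    exact zero_mem _
  -- With `y = (σ x)⁻¹` in the maximal ideal, `σ ϖ = y ^ k * σ (x ^ k * ϖ)` lies in `𝓂[K] ^ k` for
  -- all `k`, contradicting injectivity of `σ`.
  exfalso
  obtain ⟨ϖ, hϖ⟩ := IsDiscreteValuationRing.exists_irreducible 𝒪[K]
  have hϖm : ϖ ∈ 𝓂[K] := (mem_maximalIdeal _).2 hϖ.not_isUnit
  have hzero : (⟨σ ϖ, hmax ϖ hϖm⟩ : 𝒪[K]) = 0 :=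
    IsHausdorff.haus (I := 𝓂[K]) inferInstance _ fun k => by
      rw [SModEq.zero, smul_eq_mul, Ideal.mul_top]
      have hmul : (⟨x, hx⟩ : 𝒪[K]) ^ k * ϖ ∈ 𝓂[K] := Ideal.mul_mem_left _ _ hϖm
      have : (⟨σ ϖ, hmax ϖ hϖm⟩ : 𝒪[K]) = y ^ k * ⟨_, hmax _ hmul⟩ := by
        ext
        push_cast
        rw [hyx, map_mul, map_pow, inv_pow, inv_mul_cancel_left₀ (pow_ne_zero _ hx0)]
      rw [this]
      exact Ideal.mul_mem_right _ _ (Ideal.pow_mem_pow hy k)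
  have := congrArg Subtype.val hzero
  simp only [ZeroMemClass.coe_zero, map_eq_zero] at this
  exact hϖ.ne_zero (Subtype.ext this)

end OneField

/-! ### The Galois action on the integers of `E`. -/

section Extension

variable (F E : Type*)
  [Field F] [ValuativeRel F] [TopologicalSpace F] [IsNonarchimedeanLocalField F]
  [Field E] [ValuativeRel E] [TopologicalSpace E] [IsNonarchimedeanLocalField E]
  [Algebra F E] [ValuativeExtension F E]

/-- The structure of `𝔬_F`-algebra on `𝔬_E`. -/
abbrev integerAlgebra : Algebra 𝒪[F] 𝒪[E] := (integerMap F E).toAlgebra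

attribute [local instance] integerAlgebra

instance isScalarTower_integer : IsScalarTower 𝒪[F] 𝒪[E] E := .of_algebraMap_eq fun _ => rfl

instance faithfulSMul_integer : FaithfulSMul 𝒪[F] 𝒪[E] := by
  rw [faithfulSMul_iff_algebraMap_injective]
  intro x y h
  exact Subtype.ext ((algebraMap F E).injective (congrArg Subtype.val h))

/-- Automorphisms are not assumed continuous; `map_mem_integer` supplies the stability of `𝒪[E]`. -/
instance mulSemiringAction_integer : MulSemiringAction (E ≃ₐ[F] E) 𝒪[E] where
  smul σ x := ⟨σ x, map_mem_integer (σ : E →+* E) x.2⟩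
  one_smul _ := rfl
  mul_smul _ _ _ := rfl
  smul_zero σ := Subtype.ext (map_zero σ)
  smul_one σ := Subtype.ext (map_one σ)
  smul_add σ x y := Subtype.ext (map_add σ (x : E) y)
  smul_mul σ x y := Subtype.ext (map_mul σ (x : E) y)

variable {F E} in
theorem mem_integer_of_algebraMap_mem {x : F} (hx : algebraMap F E x ∈ 𝒪[E]) : x ∈ 𝒪[F] := by
  rw [Valuation.mem_integer_iff, ← map_one (valuation _), ← Valuation.Compatible.vle_iff_le] at hx ⊢
  rw [← map_one (algebraMap F E)] at hx
  exact (ValuativeExtension.vle_iff_vle x 1).1 hx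

variable [FiniteDimensional F E] [IsGalois F E]

instance isGaloisGroup_integer : IsGaloisGroup (E ≃ₐ[F] E) 𝒪[F] 𝒪[E] where
  faithful := by
    refine ⟨fun {σ τ} h => AlgEquiv.ext fun x => ?_⟩
    obtain ⟨a, b, hb, rfl⟩ := IsFractionRing.div_surjective (A := 𝒪[E]) x
    rw [map_div₀, map_div₀]
    exact congrArg₂ (· / ·) (congrArg Subtype.val (h a)) (congrArg Subtype.val (h b))
  commutes := ⟨fun σ a x => Subtype.ext <| by
    change σ (algebraMap F E a * x) = algebraMap F E a * σ x
    rw [map_mul, σ.commutes]⟩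
  isInvariant := ⟨fun x hx => by
    obtain ⟨y, hy⟩ := (IsGalois.mem_bot_iff_fixed (F := F) (x : E)).2
      fun σ => congrArg Subtype.val (hx σ)
    have hy' : algebraMap F E y = x := hy
    exact ⟨⟨y, mem_integer_of_algebraMap_mem (hy' ▸ x.2)⟩, Subtype.ext hy⟩⟩

instance moduleFinite_integer : Module.Finite 𝒪[F] 𝒪[E] := by
  have : Algebra.IsIntegral 𝒪[F] 𝒪[E] :=
    IsGaloisGroup.isInvariant.isIntegral 𝒪[F] 𝒪[E] (E ≃ₐ[F] E)
  have := IsIntegralClosure.of_isIntegrallyClosed 𝒪[E] 𝒪[F] E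
  exact IsIntegralClosure.finite 𝒪[F] F E 𝒪[E]

end Extension

section OneField

variable {K : Type*} [Field K] [ValuativeRel K] [TopologicalSpace K] [IsNonarchimedeanLocalField K]

theorem coe_mem_primePow_iff {n : ℕ} {x : 𝒪[K]} : (x : K) ∈ primePow K n ↔ x ∈ 𝓂[K] ^ n := by
  constructor
  · rintro ⟨y, hy, hyx⟩
    rwa [← show y = x from Subtype.ext hyx]
  · exact fun hx => ⟨x, hx, rfl⟩

theorem mem_unitGroup_iff {n : ℕ} {x : Kˣ} :
    x ∈ unitGroup K n ↔ ∃ u : 𝒪[K]ˣ, (u : 𝒪[K]) - 1 ∈ 𝓂[K] ^ n ∧ ((u : 𝒪[K]) : K) = x := by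
  simp only [unitGroup, Subgroup.mem_map, MonoidHom.mem_ker, Units.ext_iff, Units.coe_map,
    Units.val_one]
  refine exists_congr fun u => and_congr ?_ Iff.rfl
  rw [← Ideal.Quotient.eq, map_one]
  rfl

end OneField

/-! ### Ramification groups, the Herbrand function and norms of unit groups. -/

section Extension

variable {F E : Type*}
  [Field F] [ValuativeRel F] [TopologicalSpace F] [IsNonarchimedeanLocalField F]
  [Field E] [ValuativeRel E] [TopologicalSpace E] [IsNonarchimedeanLocalField E]
  [Algebra F E] [ValuativeExtension F E] [FiniteDimensional F E] [IsGalois F E]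

attribute [local instance] integerAlgebra

theorem mem_ramificationGroup_iff {i : ℤ} {σ : E ≃ₐ[F] E} :
    σ ∈ ramificationGroup F E i ↔ ∀ x : 𝒪[E], σ • x - x ∈ 𝓂[E] ^ (i + 1).toNat := by
  simp_rw [← coe_mem_primePow_iff]
  exact ⟨fun h x => h x x.2, fun h x hx => h ⟨x, hx⟩⟩

theorem card_ramificationGroup_zero :
    Nat.card (ramificationGroup F E 0) = ramificationIndex F E := by
  have h : ramificationGroup F E 0 = (𝓂[E]).inertia (E ≃ₐ[F] E) := by
    ext σ
    rw [mem_ramificationGroup_iff]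
    simp only [zero_add, Int.toNat_one, pow_one]
    rfl
  rw [h, DVRGalois.card_inertia 𝒪[F] (E ≃ₐ[F] E)]
  rfl

theorem IsTamelyRamified.natCast_ne_zero (htame : IsTamelyRamified F E) :
    ((𝓂[E].ramificationIdx 𝒪[F] : ℕ) : 𝓀[F]) ≠ 0 :=
  fun h => htame ((ringChar.spec _ _).1 h)

theorem IsTamelyRamified.ramificationGroup_eq_bot (htame : IsTamelyRamified F E) {i : ℤ}
    (hi : 1 ≤ i) : ramificationGroup F E i = ⊥ := by
  rw [eq_bot_iff]
  intro σ hσ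
  rw [mem_ramificationGroup_iff] at hσ
  exact DVRGalois.eq_one_of_forall_mem_sq 𝒪[F] htame.natCast_ne_zero
    fun x => Ideal.pow_le_pow_right (by omega) (hσ x)

theorem IsTamelyRamified.ramificationIndex_pos (htame : IsTamelyRamified F E) :
    0 < ramificationIndex F E :=
  Nat.pos_of_ne_zero fun h => htame (h ▸ dvd_zero _)

theorem IsTamelyRamified.herbrandPhi_of_nonneg (htame : IsTamelyRamified F E) {u : ℝ}
    (hu : 0 ≤ u) : herbrandPhi F E u = u / ramificationIndex F E := by
  have h : herbrandPhi F E u = ∫ _ in (0 : ℝ)..u, ((ramificationIndex F E : ℕ) : ℝ)⁻¹ := by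
    refine intervalIntegral.integral_congr_ae (Filter.Eventually.of_forall fun t ht => ?_)
    rw [Set.uIoc_of_le hu] at ht
    rw [realRamificationGroup, realRamificationGroup, Int.ceil_zero,
      htame.ramificationGroup_eq_bot (Int.one_le_ceil_iff.2 ht.1), Subgroup.relIndex_bot_left,
      card_ramificationGroup_zero]
  rw [h, intervalIntegral.integral_const, sub_zero, smul_eq_mul, div_eq_mul_inv]

theorem herbrandPhi_of_nonpos {u : ℝ} (hu1 : -1 ≤ u) (hu : u ≤ 0) : herbrandPhi F E u = u := by
  have h : herbrandPhi F E u = ∫ _ in (0 : ℝ)..u, (1 : ℝ) := by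
    refine intervalIntegral.integral_congr_ae (Filter.Eventually.of_forall fun t ht => ?_)
    rw [Set.uIoc_of_ge hu] at ht
    have ht0 : ⌈t⌉ = 0 := Int.ceil_eq_iff.2 ⟨by push_cast; linarith [ht.1], by simpa using ht.2⟩
    rw [realRamificationGroup, realRamificationGroup, Int.ceil_zero, ht0, Subgroup.relIndex_self]
    simp
  rw [h, intervalIntegral.integral_const, sub_zero, smul_eq_mul, mul_one]

/-- `Function.invFunOn` only chooses some preimage in `[-1, ∞)`; a negative one is excluded because
`φ` is the identity on `[-1, 0]`. -/
theorem IsTamelyRamified.herbrandPsi_of_nonneg (htame : IsTamelyRamified F E) {ν : ℝ}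
    (hν : 0 ≤ ν) : herbrandPsi F E ν = ramificationIndex F E * ν := by
  have he : (0 : ℝ) < ramificationIndex F E := by exact_mod_cast htame.ramificationIndex_pos
  have hex : ∃ u ∈ Set.Ici (-1 : ℝ), herbrandPhi F E u = ν := by
    refine ⟨ramificationIndex F E * ν, ?_, ?_⟩
    · exact le_trans (by norm_num) (mul_nonneg he.le hν)
    · rw [htame.herbrandPhi_of_nonneg (mul_nonneg he.le hν), mul_div_cancel_left₀ _ he.ne']
  have hmem : herbrandPsi F E ν ∈ Set.Ici (-1 : ℝ) := Function.invFunOn_mem hex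
  have heq : herbrandPhi F E (herbrandPsi F E ν) = ν := Function.invFunOn_eq hex
  rcases le_or_gt 0 (herbrandPsi F E ν) with h | h
  · rw [htame.herbrandPhi_of_nonneg h, div_eq_iff he.ne'] at heq
    rw [heq, mul_comm]
  · rw [herbrandPhi_of_nonpos hmem h.le] at heq
    linarith

theorem norm_eq_of_algebraMap_eq_prod_smul {x : 𝒪[E]} {a : 𝒪[F]}
    (h : algebraMap 𝒪[F] 𝒪[E] a = ∏ σ : E ≃ₐ[F] E, σ • x) : Algebra.norm F (x : E) = a := by
  apply (algebraMap F E).injective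
  rw [Algebra.norm_eq_prod_automorphisms]
  have := congrArg (𝒪[E].subtype) h
  rw [map_prod] at this
  exact this.symm

/-- The hypothesis is `e(n - 1) < m`, written without subtraction so that it also serves `n = 0`. -/
theorem norm_mem_unitGroup {m n : ℕ}
    (h : ramificationIndex F E * n < m + ramificationIndex F E) {x : Eˣ}
    (hx : x ∈ unitGroup E m) : Units.map (Algebra.norm F : E →* F) x ∈ unitGroup F n := by
  obtain ⟨u, hu, hux⟩ := mem_unitGroup_iff.1 hx
  obtain ⟨a, ha⟩ := DVRGalois.exists_algebraMap_eq_prod_smul 𝒪[F] (G := E ≃ₐ[F] E) (u : 𝒪[E])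
  have hau : IsUnit a := by
    refine isUnit_of_map_unit (algebraMap 𝒪[F] 𝒪[E]) a ?_
    rw [ha, IsUnit.prod_iff]
    exact fun σ _ => u.isUnit.map (MulSemiringAction.toRingHom (E ≃ₐ[F] E) 𝒪[E] σ)
  refine mem_unitGroup_iff.2 ⟨hau.unit, ?_, ?_⟩
  · refine DVRGalois.mem_pow_of_algebraMap_mem_pow (B := 𝒪[E]) h ?_
    have := DVRGalois.prod_smul_sub_prod_smul_mem (G := E ≃ₐ[F] E) hu
    simpa [ha] using this
  · rw [IsUnit.unit_spec, Units.coe_map, ← hux]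
    exact (norm_eq_of_algebraMap_eq_prod_smul ha).symm

theorem mem_map_norm_of_prod_smul_eq {m : ℕ} {w : 𝒪[F]ˣ} {y : 𝒪[E]} (hy : y - 1 ∈ 𝓂[E] ^ m)
    (h : ∏ σ : E ≃ₐ[F] E, σ • y = algebraMap 𝒪[F] 𝒪[E] w) {x : Fˣ} (hx : ((w : 𝒪[F]) : F) = x) :
    x ∈ (unitGroup E m).map (Units.map (Algebra.norm F : E →* F)) := by
  have hyu : IsUnit y := by
    have hu : IsUnit (∏ σ : E ≃ₐ[F] E, σ • y) := h ▸ w.isUnit.map _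
    simpa using IsUnit.prod_iff.1 hu 1 (Finset.mem_univ _)
  obtain ⟨u, rfl⟩ := hyu
  refine ⟨Units.map (𝒪[E].subtype : 𝒪[E] →* E) u, mem_unitGroup_iff.2 ⟨u, hy, rfl⟩, ?_⟩
  ext
  rw [← hx]
  exact norm_eq_of_algebraMap_eq_prod_smul h.symm

theorem IsTamelyRamified.map_norm_unitGroup (htame : IsTamelyRamified F E) {m n : ℕ} (hn : n ≠ 0)
    (hmn : m ≤ ramificationIndex F E * n)
    (h : ramificationIndex F E * n < m + ramificationIndex F E) :
    (unitGroup E m).map (Units.map (Algebra.norm F : E →* F)) = unitGroup F n := by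
  refine le_antisymm (Subgroup.map_le_iff_le_comap.2 fun x hx => norm_mem_unitGroup h hx) ?_
  intro x hx
  obtain ⟨w, hw, hwx⟩ := mem_unitGroup_iff.1 hx
  obtain ⟨y, hy, hyw⟩ :=
    DVRGalois.exists_prod_smul_eq (B := 𝒪[E]) (E ≃ₐ[F] E) htame.natCast_ne_zero hn hw
  exact mem_map_norm_of_prod_smul_eq (Ideal.pow_le_pow_right hmn hy) hyw hwx

theorem IsUnramified.map_norm_unitGroup_zero (hunr : IsUnramified F E) :
    (unitGroup E 0).map (Units.map (Algebra.norm F : E →* F)) = unitGroup F 0 := by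
  refine le_antisymm (Subgroup.map_le_iff_le_comap.2 fun x hx =>
    norm_mem_unitGroup (m := 0) (by rw [hunr]; norm_num) hx) ?_
  intro x hx
  obtain ⟨w, -, hwx⟩ := mem_unitGroup_iff.1 hx
  obtain ⟨y, hyw⟩ :=
    DVRGalois.exists_prod_smul_eq_of_ramificationIdx_eq_one (B := 𝒪[E]) (E ≃ₐ[F] E) hunr w
  exact mem_map_norm_of_prod_smul_eq (by simp) hyw hwx

end Extension

end LocalFieldNorm

end

theorem mainTheorem8 (F E : Type*)
    [Field F] [ValuativeRel F] [TopologicalSpace F] [IsNonarchimedeanLocalField F]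
    [Field E] [ValuativeRel E] [TopologicalSpace E] [IsNonarchimedeanLocalField E]
    [Algebra F E] [ValuativeExtension F E] [FiniteDimensional F E] [IsGalois F E]
    (htame : LocalFieldNorm.IsTamelyRamified F E) (ν : ℝ) (hν : 0 ≤ ν)
    (hν0 : 0 < ν ∨ LocalFieldNorm.IsUnramified F E) :
    (LocalFieldNorm.realUnitGroup E (LocalFieldNorm.herbrandPsi F E ν)).map
        (Units.map (Algebra.norm F : E →* F)) =
      LocalFieldNorm.realUnitGroup F ν := by
  rw [htame.herbrandPsi_of_nonneg hν, LocalFieldNorm.realUnitGroup, LocalFieldNorm.realUnitGroup]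
  rcases hν.eq_or_lt with rfl | hpos
  · rw [mul_zero, Nat.ceil_zero]
    exact (hν0.resolve_left (lt_irrefl _)).map_norm_unitGroup_zero
  · have he : (0 : ℝ) < LocalFieldNorm.ramificationIndex F E := by
      exact_mod_cast htame.ramificationIndex_pos
    refine htame.map_norm_unitGroup (Nat.ceil_pos.2 hpos).ne' ?_ ?_
    · rw [Nat.ceil_le]
      push_cast
      exact mul_le_mul_of_nonneg_left (Nat.le_ceil ν) he.le
    · rw [← Nat.cast_lt (α := ℝ)]
      push_cast
      -- `e⌈ν⌉ < eν + e ≤ ⌈eν⌉ + e`.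
      have h1 := mul_lt_mul_of_pos_left (Nat.ceil_lt_add_one hν) he
      have h2 := Nat.le_ceil ((LocalFieldNorm.ramificationIndex F E : ℝ) * ν)
      linarith
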